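/- Let $X$ be a geodesic metric space that is hyperbolic in the sense of Gromov (not assumed proper), with Gromov boundary $\partial X$, and let a group $\Gamma$ act on $X$ by isometries, hence also on $\partial X$. An element $h\in\Gamma$ is loxodromic if $k\mapsto h^k\cdot x$ is a quasi-isometric embedding $\mathbb Z\to X$ for some (equivalently every) $x\in X$; then $\partial_+h=\lim_{k\to+\infty}h^kx$ and $\partial_-h=\lim_{k\to+\infty}h^{-k}x$ are distinct points of $\partial X$ independent of $x$. Put $\partial h=\{\partial_-h,\partial_+h\}$, and let $\mathrm{Stab}(\partial_\pm h)\le\Gamma$ be the subgroup of elements fixing both $\partial_-h$ and $\partial_+h$. A loxodromic element $h$ is WWPD if for all $x\in X$ and $R>0$ there is an integer $M\ge1$ such that every subset $Z\subset\Gamma$ with the following two properties is finite: (a) $d(x,gx)<R$ and $d(h^Mx,gh^Mx)<R$ for each $g\in Z$; (b) no two distinct elements of $Z$ lie in the same left coset of $\mathrm{Stab}(\partial_\pm h)$. Suppose that $\Gamma$ contains a loxodromic WWPD element. Then one of the following holds: (1) the action is nonelementary: there are loxodromic $\gamma,\delta\in\Gamma$ with $\partial\gamma\cap\partial\delta=\emptyset$;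 or (2) the action is axial: there are points $\xi\ne\eta$ in $\partial X$ such that $g\{\xi,\eta\}=\{\xi,\eta\}$ for every $g\in\Gamma$. Moreover, the action is not quasiparabolic: there do not exist a point $\xi\in\partial X$ fixed by every element of $\Gamma$ and loxodromic elements $g_1,g_2\in\Gamma$ with $\partial g_1\cap\partial g_2=\{\xi\}$. -/

import Mathlib

open Filter
open scoped Pointwise

noncomputable section

namespace HyperbolicAction

/-! ### Gromov hyperbolic geodesic spaces -/

/-- The Gromov product `(x|y)_p`. -/
def gromovProduct {X : Type*} [MetricSpace X] (p x y : X) : ℝ :=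
  (dist p x + dist p y - dist x y) / 2

/-- Hyperbolicity in the sense of Gromov: for some `δ`, all points satisfy
`(x|z)_p ≥ min ((x|y)_p) ((y|z)_p) - δ`. -/
class GromovHyperbolic (X : Type*) [MetricSpace X] : Prop where
  exists_delta : ∃ δ : ℝ, ∀ p x y z : X,
    min (gromovProduct p x y) (gromovProduct p y z) - δ ≤ gromovProduct p x z

/-- Any two points are joined by an isometrically embedded segment. -/
class GeodesicSpace (X : Type*) [MetricSpace X] : Prop where
  exists_geodesic : ∀ x y : X, ∃ c : ℝ → X, c 0 = x ∧ c (dist x y) = y ∧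
    ∀ s ∈ Set.Icc 0 (dist x y), ∀ t ∈ Set.Icc 0 (dist x y), dist (c s) (c t) = |s - t|

section Boundary

variable (X : Type*) [MetricSpace X]

/-- Sequences converging at infinity: `(u_i|u_j)_p → ∞` as `i, j → ∞`
(for every base point `p`, equivalently for one). -/
def InfSeq : Type _ :=
  {u : ℕ → X // ∀ p : X,
    Tendsto (fun n : ℕ × ℕ => gromovProduct p (u n.1) (u n.2)) atTop atTop}

variable {X}

/-- Two sequences converging at infinity are equivalent when `(u_n|v_n)_p → ∞`. -/
def InfSeq.Equivalent (u v : InfSeq X) : Prop :=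
  ∀ p : X, Tendsto (fun n : ℕ => gromovProduct p (u.1 n) (v.1 n)) atTop atTop

lemma gromovProduct_comm (p x y : X) : gromovProduct p x y = gromovProduct p y x := by
  unfold gromovProduct
  rw [dist_comm x y]
  ring

variable (X) in
instance infSeqSetoid [GromovHyperbolic X] : Setoid (InfSeq X) where
  r := InfSeq.Equivalent
  iseqv :=
    { refl := fun u p => (u.2 p).comp tendsto_atTop_diagonal
      symm := fun {u v} h p => by
        simpa only [gromovProduct_comm p (u.1 _) (v.1 _)] using h p
      trans := fun {u v w} h h' p => by
        obtain ⟨δ, hδ⟩ := GromovHyperbolic.exists_delta (X := X)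
        refine tendsto_atTop.2 fun b => ?_
        filter_upwards [tendsto_atTop.1 (h p) (b + δ), tendsto_atTop.1 (h' p) (b + δ)]
          with n h1 h2
        have h3 := hδ p (u.1 n) (v.1 n) (w.1 n)
        have h4 := le_min h1 h2
        linarith }

variable (X) in
/-- The Gromov boundary `∂X`. -/
def GromovBoundary [GromovHyperbolic X] : Type _ := Quotient (infSeqSetoid X)

/-- `u_n → ξ ∈ ∂X`. -/
def ConvergesTo [GromovHyperbolic X] (u : ℕ → X) (ξ : GromovBoundary X) : Prop :=
  ∃ hu, ξ = Quotient.mk (infSeqSetoid X) ⟨u, hu⟩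

end Boundary

/-! ### Isometric actions and their extension to the boundary -/

section Action

variable {Γ X : Type*} [Group Γ] [MetricSpace X] [MulAction Γ X] [IsIsometricSMul Γ X]

lemma gromovProduct_smul (g : Γ) (p x y : X) :
    gromovProduct p (g • x) (g • y) = gromovProduct (g⁻¹ • p) x y := by
  have h : ∀ z : X, dist p (g • z) = dist (g⁻¹ • p) z := fun z => by
    rw [← dist_smul g (g⁻¹ • p) z, smul_inv_smul]
  simp only [gromovProduct, h, dist_smul]

/-- The translate of a sequence converging at infinity. -/
def InfSeq.translate (g : Γ) (u : InfSeq X) : InfSeq X :=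
  ⟨fun n => g • u.1 n, fun p => by
    simpa only [gromovProduct_smul] using u.2 (g⁻¹ • p)⟩

variable [GromovHyperbolic X]

/-- The extension of an isometric action to the Gromov boundary: `g • [u_n] = [g • u_n]`. -/
instance boundaryAction : MulAction Γ (GromovBoundary X) where
  smul g := Quotient.map (InfSeq.translate g) fun u v h p => by
    simpa only [InfSeq.translate, gromovProduct_smul] using h (g⁻¹ • p)
  one_smul ξ := by
    induction ξ using Quotient.inductionOn with
    | _ u =>
      exact congrArg (Quotient.mk _) (Subtype.ext (funext fun n => one_smul Γ (u.1 n)))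
  mul_smul g h ξ := by
    induction ξ using Quotient.inductionOn with
    | _ u =>
      exact congrArg (Quotient.mk _) (Subtype.ext (funext fun n => mul_smul g h (u.1 n)))

variable (X)

/-- The orbit map `k ↦ h ^ k • x` is a quasi-isometric embedding `ℤ → X` for some `x`
(equivalently, for every `x`). -/
def IsLoxodromic (h : Γ) : Prop :=
  ∃ x : X, ∃ K C : ℝ, 1 ≤ K ∧ 0 ≤ C ∧ ∀ m n : ℤ,
    (1 / K) * |(m : ℝ) - n| - C ≤ dist (h ^ m • x) (h ^ n • x) ∧
      dist (h ^ m • x) (h ^ n • x) ≤ K * |(m : ℝ) - n| + C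

/-- `ξ` is the attracting point `∂₊h`: it is the limit of `h ^ k • x`, `k → ∞`, for all `x`. -/
def IsAttractor (h : Γ) (ξ : GromovBoundary X) : Prop :=
  ∀ x : X, ConvergesTo (fun k : ℕ => h ^ k • x) ξ

/-- `ξ` is the repelling point `∂₋h`: it is the limit of `h ^ (-k) • x`, `k → ∞`, for all `x`. -/
def IsRepeller (h : Γ) (ξ : GromovBoundary X) : Prop :=
  ∀ x : X, ConvergesTo (fun k : ℕ => h⁻¹ ^ k • x) ξ

/-- `∂h = {∂₋h, ∂₊h}`, for a loxodromic `h`. -/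
def endpoints (h : Γ) : Set (GromovBoundary X) :=
  {ξ | IsRepeller X h ξ ∨ IsAttractor X h ξ}

/-- `Stab(∂±h)`: the elements of `Γ` that fix each of the points `∂₋h` and `∂₊h`. -/
def orderedStabilizer (h : Γ) : Subgroup Γ :=
  fixingSubgroup Γ (endpoints X h)

/-- `h` is a WWPD element: it is loxodromic, and for every `x` and `R > 0` there is `M ≥ 1` such
that every set `Z ⊆ Γ` is finite if its elements move `x` and `h ^ M • x` less than `R` and lie
in pairwise different left cosets of `Stab(∂±h)`. -/
def IsWWPD (h : Γ) : Prop :=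
  IsLoxodromic X h ∧ ∀ x : X, ∀ R : ℝ, 0 < R → ∃ M : ℕ, 1 ≤ M ∧ ∀ Z : Set Γ,
    (∀ g ∈ Z, dist x (g • x) < R ∧ dist (h ^ M • x) (g • h ^ M • x) < R) →
    Set.InjOn (fun g : Γ => (g : Γ ⧸ orderedStabilizer X h)) Z → Z.Finite

/-- Loxodromic elements with disjoint endpoint pairs. -/
def IndependentLoxodromics (γ δ : Γ) : Prop :=
  IsLoxodromic X γ ∧ IsLoxodromic X δ ∧ endpoints X γ ∩ endpoints X δ = ∅

variable (Γ)

def IsNonelementary : Prop := ∃ γ δ : Γ, IndependentLoxodromics X γ δ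

def IsAxial : Prop :=
  ∃ ξ η : GromovBoundary X, ξ ≠ η ∧
    ∀ g : Γ, g • ({ξ, η} : Set (GromovBoundary X)) = {ξ, η}

/-- `Γ` fixes a boundary point `ξ`, and two loxodromic elements have `ξ` as their only common
endpoint. -/
def IsQuasiparabolic : Prop :=
  ∃ ξ : GromovBoundary X, (∀ g : Γ, g • ξ = ξ) ∧
    ∃ g₁ g₂ : Γ, IsLoxodromic X g₁ ∧ IsLoxodromic X g₂ ∧
      endpoints X g₁ ∩ endpoints X g₂ = {ξ}

end Action

end HyperbolicAction

end

set_option linter.unusedSectionVars false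

namespace HyperbolicAction

/-! ### Gromov products -/

section Product

variable {X : Type*} [MetricSpace X]

/-! The heart is that an isometry `g` fixing one endpoint of a WWPD element fixes the other
(`IsWWPD.smul_repeller_eq`). Let `h` have attractor `ξ` and repeller `η`, with `g • ξ = ξ`. Then `g`
moves every `h ^ n • x` by a bounded amount, so the conjugates of `g` by powers of `h` move `x` and
its relevant translate by a uniformly bounded amount. By WWPD they meet only finitely many cosets of
the stabilizer. But if `g • η ≠ η`, they send `η` to the points `h⁻¹ ^ n • g • η`, which are
pairwise distinct because a power of `h` fixes only `ξ` and `η`.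

If the endpoint pairs of `f` and of a conjugate share a point, the conjugate fixes it, hence fixes
both endpoints of `f`, and the pairs agree. So either every translate of the pair is the pair itself
(axial), or `f` and some conjugate are independent. A global fixed point would be an endpoint of
`f`, making both endpoints globally fixed; any two loxodromics then share two endpoints.

The boundary dynamics rests on one estimate, `exists_superadditive`: orbit distances of a loxodromic
are superadditive up to a constant. -/

lemma exists_pos_delta (X : Type*) [MetricSpace X] [GromovHyperbolic X] :
    ∃ δ : ℝ, 0 < δ ∧ ∀ p x y z : X,
      min (gromovProduct p x y) (gromovProduct p y z) - δ ≤ gromovProduct p x z := by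
  obtain ⟨δ, hδ⟩ := GromovHyperbolic.exists_delta (X := X)
  refine ⟨max δ 1, by positivity, fun p x y z => ?_⟩
  have := hδ p x y z
  have := le_max_left δ 1
  linarith

lemma le_gromovProduct_of_le {δ c : ℝ}
    (hδ : ∀ p x y z : X,
      min (gromovProduct p x y) (gromovProduct p y z) - δ ≤ gromovProduct p x z)
    {p x y z : X} (h₁ : c ≤ gromovProduct p x y) (h₂ : c ≤ gromovProduct p y z) :
    c - δ ≤ gromovProduct p x z := by
  have := hδ p x y z
  have := le_min h₁ h₂
  linarith

lemma gromovProduct_sub_dist_le (p q x y : X) :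
    gromovProduct p x y - dist p q ≤ gromovProduct q x y := by
  unfold gromovProduct
  have := dist_triangle p q x
  have := dist_triangle p q y
  linarith

/-- Convergence at infinity does not depend on the base point. -/
lemma tendsto_gromovProduct_basepoint {ι : Type*} {l : Filter ι} {u v : ι → X} {p : X}
    (h : Tendsto (fun i => gromovProduct p (u i) (v i)) l atTop) (q : X) :
    Tendsto (fun i => gromovProduct q (u i) (v i)) l atTop :=
  tendsto_atTop_mono (fun i => gromovProduct_sub_dist_le p q (u i) (v i))
    (tendsto_atTop_add_const_right _ (-dist p q) h)

end Product

/-! ### Sequences with shift-invariant distances -/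

section Shift

variable {X : Type*} [MetricSpace X]

/-- Otherwise `a (2 ^ k)` would grow at most linearly in `k`, against a lower bound exponential in
`k`. -/
lemma exists_add_le_of_linear_growth {a : ℕ → ℝ} {K C : ℝ} (hK : 0 < K)
    (ha : ∀ n : ℕ, 1 / K * n - C ≤ a n) (L : ℝ) : ∃ N, 1 ≤ N ∧ a N + L ≤ a (2 * N) := by
  by_contra! H
  have h1 : ∀ k : ℕ, a (2 ^ k) ≤ a 1 + k * L := by
    intro k
    induction k with
    | zero => simp
    | succ k ih =>
      have := H (2 ^ k) Nat.one_le_two_pow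
      rw [pow_succ']
      push_cast
      linarith
  obtain ⟨j, hj⟩ := exists_nat_gt (K * (|C| + |a 1| + 2 * |L|))
  have h2 := h1 (2 * j)
  -- The even exponent yields the quadratic bound `(1 + j) ^ 2` from Bernoulli, enough to beat a
  -- linear one.
  have h3 := ha (2 ^ (2 * j))
  have h4 : (1 + j : ℝ) ≤ 2 ^ j := by
    have := one_add_mul_le_pow (a := (1 : ℝ)) (by norm_num) j
    norm_num at this
    linarith
  have h5 : (1 + j : ℝ) ^ 2 ≤ 2 ^ (2 * j) := by
    rw [mul_comm, pow_mul]
    exact pow_le_pow_left₀ (by positivity) h4 2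
  have h6 : (2 : ℝ) ^ (2 * j) ≤ K * (C + a 1 + 2 * j * L) := by
    push_cast at h2 h3
    have : 1 / K * (2 : ℝ) ^ (2 * j) ≤ C + a 1 + 2 * j * L := by linarith
    rwa [one_div, inv_mul_le_iff₀ hK] at this
  have h7 : C + a 1 + 2 * j * L ≤ (|C| + |a 1| + 2 * |L|) * (1 + j) := by
    have hj0 : (0 : ℝ) ≤ j := by positivity
    nlinarith [le_abs_self C, le_abs_self (a 1), mul_le_mul_of_nonneg_left (le_abs_self L) hj0,
      mul_nonneg hj0 (abs_nonneg C), mul_nonneg hj0 (abs_nonneg (a 1)), abs_nonneg L]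
  have h8 : (1 + j : ℝ) ^ 2 ≤ K * (|C| + |a 1| + 2 * |L|) * (1 + j) := by
    have := mul_le_mul_of_nonneg_left h7 hK.le
    linarith
  have h9 : (0 : ℝ) < 1 + j := by positivity
  nlinarith

/-- Local-to-global: the four-point condition at `p (n + 1)` leaves two cases. One contradicts the
growth at the previous step, the other is the growth at the next. -/
lemma add_le_of_doubling {δ L : ℝ} (hδ0 : 0 < δ)
    (hδ : ∀ p x y z : X,
      min (gromovProduct p x y) (gromovProduct p y z) - δ ≤ gromovProduct p x z)
    {p : ℕ → X} {b : ℕ → ℝ} (hb : ∀ m n, dist (p m) (p (m + n)) = b n)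
    (hL : 5 * δ ≤ L) (h2 : b 1 + L ≤ b 2) (n : ℕ) : b n + (L - 2 * δ) ≤ b (n + 1) := by
  induction n with
  | zero =>
    have h0 : b 0 = 0 := by rw [← hb 0 0]; simp
    have := dist_triangle (p 0) (p (0 + 1)) (p (0 + 2))
    have e : dist (p (0 + 1)) (p (0 + 2)) = b 1 := hb 1 1
    rw [hb, hb, e] at this
    norm_num
    linarith
  | succ n ih =>
    have h := hδ (p (n + 1)) (p n) (p 0) (p (n + 2))
    have e1 : dist (p n) (p (n + 1)) = b 1 := hb n 1
    have e2 : dist (p n) (p (n + 2)) = b 2 := hb n 2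
    have e3 : dist (p (n + 1)) (p (n + 2)) = b 1 := hb (n + 1) 1
    have e4 : ∀ k, dist (p 0) (p k) = b k := fun k => by simpa using hb 0 k
    simp only [gromovProduct, dist_comm (p (n + 1)) (p n), dist_comm _ (p 0), e1, e2, e3, e4,
      sub_le_iff_le_add, min_le_iff] at h
    rcases h with h | h <;> linarith

/-- A sequence with shift-invariant distances that grow linearly is a rough geodesic. -/
lemma exists_superadditive [GromovHyperbolic X] {p : ℕ → X} {a : ℕ → ℝ}
    (hp : ∀ m n, dist (p m) (p (m + n)) = a n) {K C : ℝ} (hK : 0 < K)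
    (ha : ∀ n : ℕ, 1 / K * n - C ≤ a n) : ∃ D, ∀ m n, a m + a n ≤ a (m + n) + D := by
  obtain ⟨δ, hδ0, hδ⟩ := exists_pos_delta X
  -- Along multiples of `N` each step gains at least `3 * δ`, which outweighs the hyperbolicity
  -- error.
  obtain ⟨N, hN, hN2⟩ := exists_add_le_of_linear_growth hK ha (5 * δ)
  have hb : ∀ m n, dist (p (N * m)) (p (N * (m + n))) = a (N * n) := fun m n => by
    rw [mul_add, hp]
  have hstep : ∀ n, a (N * n) + 3 * δ ≤ a (N * (n + 1)) := fun n => by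
    have := add_le_of_doubling (p := fun n => p (N * n)) (b := fun n => a (N * n)) hδ0 hδ hb
      le_rfl (by simpa [mul_comm] using hN2) n
    linarith
  have hmul : ∀ m n, a (N * m) + a (N * n) ≤ a (N * (m + n)) + (a N + 2 * δ) := by
    intro m n
    have h0 : a 0 = 0 := by rw [← hp 0 0]; simp
    rcases n with _ | n
    · have hN0 : 0 ≤ a N := by rw [← hp 0 N]; exact dist_nonneg
      simp only [mul_zero, h0, add_zero]
      linarith
    -- The gains `hstep m` and `hstep n` exclude one term of the minimum; the other is the claim.
    have h := hδ (p (N * m)) (p (N * 0)) (p (N * (m + (n + 1)))) (p (N * (m + 1)))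
    have e1 : ∀ k, dist (p (N * 0)) (p (N * k)) = a (N * k) := fun k => by simpa using hb 0 k
    have e2 : dist (p (N * (m + 1))) (p (N * (m + (n + 1)))) = a (N * n) := by
      rw [← hb (m + 1) n]; congr 3; ring
    simp only [gromovProduct, dist_comm _ (p (N * 0)),
      dist_comm (p (N * (m + (n + 1)))) (p (N * (m + 1))), e1, e2, hb, mul_one,
      sub_le_iff_le_add, min_le_iff] at h
    have := hstep m
    have := hstep n
    rcases h with h | h <;> linarith
  have hlip : ∀ m n, a (m + n) ≤ a m + a n ∧ a m ≤ a (m + n) + a n := by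
    intro m n
    have e1 : ∀ k, dist (p 0) (p k) = a k := fun k => by simpa using hp 0 k
    have h1 := dist_triangle (p 0) (p m) (p (m + n))
    have h2 := dist_triangle_right (p 0) (p m) (p (m + n))
    rw [e1, e1, hp] at h1 h2
    exact ⟨h1, h2⟩
  obtain ⟨A, hA⟩ : ∃ A, ∀ r < N, a r ≤ A := by
    obtain ⟨A, hA⟩ := ((Set.finite_Iio N).image a).bddAbove
    exact ⟨A, fun r hr => hA ⟨r, hr, rfl⟩⟩
  -- Each of the two remainders modulo `N` is paid for twice, at most `A` each time.
  refine ⟨4 * A + a N + 2 * δ, fun m n => ?_⟩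
  obtain ⟨m', r, hr, rfl⟩ : ∃ m' r, r < N ∧ m = N * m' + r :=
    ⟨m / N, m % N, Nat.mod_lt _ hN, (Nat.div_add_mod m N).symm⟩
  obtain ⟨n', s, hs, rfl⟩ : ∃ n' s, s < N ∧ n = N * n' + s :=
    ⟨n / N, n % N, Nat.mod_lt _ hN, (Nat.div_add_mod n N).symm⟩
  have h1 := (hlip (N * m') r).1
  have h2 := (hlip (N * n') s).1
  have h3 := hmul m' n'
  have h4 := (hlip (N * (m' + n')) r).2
  have h5 := (hlip (N * (m' + n') + r) s).2
  have h6 : N * (m' + n') + r + s = N * m' + r + (N * n' + s) := by ring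
  rw [h6] at h5
  have := hA r hr
  have := hA s hs
  linarith

end Shift

/-! ### Points of the boundary -/

section Boundary

variable {X : Type*} [MetricSpace X] [GromovHyperbolic X]

lemma exists_convergesTo (ξ : GromovBoundary X) : ∃ u : ℕ → X, ConvergesTo u ξ := by
  induction ξ using Quotient.inductionOn with
  | _ u => exact ⟨u.1, u.2, rfl⟩

lemma exists_limit {u : ℕ → X} (hu : ∀ p : X,
    Tendsto (fun n : ℕ × ℕ => gromovProduct p (u n.1) (u n.2)) atTop atTop) :
    ∃ ξ : GromovBoundary X, ConvergesTo u ξ :=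
  ⟨_, hu, rfl⟩

lemma ConvergesTo.infSeq {u : ℕ → X} {ξ : GromovBoundary X} (hu : ConvergesTo u ξ) (p : X) :
    Tendsto (fun n : ℕ × ℕ => gromovProduct p (u n.1) (u n.2)) atTop atTop :=
  hu.1 p

lemma ConvergesTo.eq_iff {u v : ℕ → X} {ξ η : GromovBoundary X} (hu : ConvergesTo u ξ)
    (hv : ConvergesTo v η) :
    ξ = η ↔ ∀ p : X, Tendsto (fun n : ℕ => gromovProduct p (u n) (v n)) atTop atTop := by
  obtain ⟨hu, rfl⟩ := hu
  obtain ⟨hv, rfl⟩ := hv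
  exact Quotient.eq (r := infSeqSetoid X)

lemma ConvergesTo.unique {u : ℕ → X} {ξ η : GromovBoundary X} (hu : ConvergesTo u ξ)
    (hv : ConvergesTo u η) : ξ = η := by
  obtain ⟨_, rfl⟩ := hu
  obtain ⟨_, rfl⟩ := hv
  rfl

lemma ConvergesTo.comp {u : ℕ → X} {ξ : GromovBoundary X} (hu : ConvergesTo u ξ) {φ : ℕ → ℕ}
    (hφ : Tendsto φ atTop atTop) : ConvergesTo (u ∘ φ) ξ := by
  have h : ∀ p : X, Tendsto (fun n : ℕ × ℕ => gromovProduct p ((u ∘ φ) n.1) ((u ∘ φ) n.2))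
      atTop atTop := fun p => by
    have := (hu.infSeq p).comp (hφ.prodMap hφ |>.mono_left prod_atTop_atTop_eq.ge
      |>.mono_right prod_atTop_atTop_eq.le)
    exact this
  refine ⟨h, (hu.eq_iff ⟨h, rfl⟩).2 fun p => ?_⟩
  exact (hu.infSeq p).comp ((tendsto_id.prodMk hφ).mono_right prod_atTop_atTop_eq.le)

lemma ConvergesTo.smul {Γ : Type*} [Group Γ] [MulAction Γ X] [IsIsometricSMul Γ X]
    {u : ℕ → X} {ξ : GromovBoundary X} (hu : ConvergesTo u ξ) (g : Γ) :
    ConvergesTo (fun n => g • u n) (g • ξ) := by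
  obtain ⟨hu, rfl⟩ := hu
  exact ⟨(InfSeq.translate g ⟨u, hu⟩).2, rfl⟩

/-- A sequence at bounded distance from one that converges at infinity has the same limit. -/
lemma ConvergesTo.of_dist_le {u v : ℕ → X} {ξ : GromovBoundary X} (hu : ConvergesTo u ξ)
    {A : ℝ} (hA : ∀ n, dist (u n) (v n) ≤ A) : ConvergesTo v ξ := by
  have hle : ∀ p x y x' y' : X, dist x x' ≤ A → dist y y' ≤ A →
      gromovProduct p x y + -(2 * A) ≤ gromovProduct p x' y' := by
    intro p x y x' y' hx hy
    unfold gromovProduct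
    have := dist_triangle_right p x x'
    have := dist_triangle_right p y y'
    have := dist_triangle4 x' x y y'
    rw [dist_comm x' x] at this
    linarith
  have hA0 : 0 ≤ A := dist_nonneg.trans (hA 0)
  have h : ∀ p : X, Tendsto (fun n : ℕ × ℕ => gromovProduct p (v n.1) (v n.2)) atTop atTop :=
    fun p => tendsto_atTop_mono (fun n => hle p _ _ _ _ (hA n.1) (hA n.2))
      (tendsto_atTop_add_const_right _ _ (hu.infSeq p))
  refine ⟨h, (hu.eq_iff ⟨h, rfl⟩).2 fun p => ?_⟩
  exact tendsto_atTop_mono (fun n => hle p _ _ _ _ (by simpa using hA0) (hA n))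
      (tendsto_atTop_add_const_right _ _ ((hu.infSeq p).comp tendsto_atTop_diagonal))

/-- Sequences converging to different points have bounded Gromov products, with a bound that
depends on only one of the two sequences. -/
lemma exists_gromovProduct_le_of_ne {ζ ξ : GromovBoundary X} (hne : ζ ≠ ξ) {v : ℕ → X}
    (hv : ConvergesTo v ξ) (p : X) :
    ∃ B : ℝ, ∃ I : ℕ, ∀ u : ℕ → X, ConvergesTo u ζ →
      ∀ᶠ i in atTop, ∀ j ≥ I, gromovProduct p (u i) (v j) ≤ B := by
  obtain ⟨δ, hδ0, hδ⟩ := exists_pos_delta X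
  obtain ⟨w, hw⟩ := exists_convergesTo ζ
  obtain ⟨B, hB⟩ : ∃ B : ℝ, ∃ᶠ n in atTop, gromovProduct p (w n) (v n) ≤ B := by
    by_contra! H
    refine hne ((hw.eq_iff hv).2 fun q => tendsto_gromovProduct_basepoint (p := p) ?_ q)
    refine tendsto_atTop.2 fun b => ?_
    filter_upwards [H b] with n hn using hn.le
  obtain ⟨⟨I₁, I₂⟩, hI⟩ := eventually_atTop.1 (tendsto_atTop.1 (hv.infSeq p) (B + 4 * δ))
  refine ⟨B + 4 * δ, max I₁ I₂, fun u hu => ?_⟩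
  obtain ⟨⟨J₁, J₂⟩, hJ⟩ := eventually_atTop.1 (tendsto_atTop.1 (hw.infSeq p) (B + 4 * δ))
  filter_upwards [tendsto_atTop.1 ((hw.eq_iff hu).1 rfl p) (B + 4 * δ), eventually_ge_atTop J₂]
    with i hi hiJ j hj
  obtain ⟨n, hn, hnB⟩ := (frequently_atTop.1 hB) (max J₁ (max I₁ I₂))
  -- Chaining `w n`, `w i`, `u i`, `v j`, `v n` loses `δ` three times, leaving a product of at least
  -- `B + δ` where `B` is the bound.
  by_contra! hlt
  have h1 := hI (j, n) (Prod.mk_le_mk.2 ⟨by omega, by omega⟩)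
  have h2 := hJ (n, i) (Prod.mk_le_mk.2 ⟨by omega, by omega⟩)
  have h3 := le_gromovProduct_of_le hδ h2 hi
  have h4 := le_gromovProduct_of_le hδ h3 (c := B + 4 * δ - δ) (z := v j) (by linarith)
  have h5 := le_gromovProduct_of_le hδ h4 (c := B + 4 * δ - δ - δ) (z := v n) (by linarith)
  linarith

end Boundary

/-! ### Orbits of loxodromic elements -/

section Loxodromic

variable {Γ X : Type*} [Group Γ] [MetricSpace X] [MulAction Γ X] [IsIsometricSMul Γ X]

lemma pow_smul_eq_of_smul_eq {G α : Type*} [Monoid G] [MulAction G α] {g : G} {a : α}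
    (h : g • a = a) (n : ℕ) : g ^ n • a = a := by
  induction n with
  | zero => rw [pow_zero, one_smul]
  | succ n ih => rw [pow_succ, mul_smul, h, ih]

lemma dist_pow_smul (h : Γ) (x : X) (m n : ℕ) :
    dist (h ^ m • x) (h ^ (m + n) • x) = dist x (h ^ n • x) := by
  rw [pow_add, mul_smul, dist_smul]

lemma dist_inv_smul (h : Γ) (x y : X) : dist (h⁻¹ • x) y = dist x (h • y) := by
  rw [← dist_smul h, smul_inv_smul]

lemma dist_inv_pow_smul_self (h : Γ) (x : X) (n : ℕ) :
    dist x (h⁻¹ ^ n • x) = dist x (h ^ n • x) := by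
  rw [inv_pow, dist_comm, dist_inv_smul]

lemma IsLoxodromic.exists_growth {h : Γ} (hh : IsLoxodromic X h) (x : X) :
    ∃ K C : ℝ, 0 < K ∧ ∀ n : ℕ, 1 / K * n - C ≤ dist x (h ^ n • x) := by
  obtain ⟨y, K, C, hK, -, hy⟩ := hh
  refine ⟨K, C + 2 * dist x y, by linarith, fun n => ?_⟩
  have h1 := (hy 0 n).1
  have h2 := dist_triangle4 y x (h ^ n • x) (h ^ n • y)
  simp only [zpow_zero, one_smul, zpow_natCast, Int.cast_zero, zero_sub, abs_neg, Int.cast_natCast,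
    Nat.abs_cast] at h1
  rw [dist_smul, dist_comm y x] at h2
  linarith

lemma IsLoxodromic.tendsto_dist {h : Γ} (hh : IsLoxodromic X h) (x : X) :
    Tendsto (fun n : ℕ => dist x (h ^ n • x)) atTop atTop := by
  obtain ⟨K, C, hK, ha⟩ := hh.exists_growth x
  refine tendsto_atTop_mono ha (tendsto_atTop_add_const_right _ (-C) ?_)
  exact tendsto_natCast_atTop_atTop.const_mul_atTop (by positivity)

lemma IsLoxodromic.inv {h : Γ} (hh : IsLoxodromic X h) : IsLoxodromic X h⁻¹ := by
  obtain ⟨x, K, C, hK, hC, hx⟩ := hh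
  refine ⟨x, K, C, hK, hC, fun m n => ?_⟩
  have := hx (-m) (-n)
  have e : |((-m : ℤ) : ℝ) - (-n : ℤ)| = |(m : ℝ) - n| := by
    rw [abs_sub_comm]; push_cast; congr 1; ring
  rwa [e, zpow_neg, zpow_neg, ← inv_zpow, ← inv_zpow] at this

lemma IsLoxodromic.conj {h : Γ} (hh : IsLoxodromic X h) (g : Γ) :
    IsLoxodromic X (g * h * g⁻¹) := by
  obtain ⟨x, K, C, hK, hC, hx⟩ := hh
  refine ⟨g • x, K, C, hK, hC, fun m n => ?_⟩
  simpa only [conj_zpow, mul_smul, inv_smul_smul, dist_smul] using hx m n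

lemma IsLoxodromic.pow {h : Γ} (hh : IsLoxodromic X h) {k : ℕ} (hk : k ≠ 0) :
    IsLoxodromic X (h ^ k) := by
  obtain ⟨x, K, C, hK, hC, hx⟩ := hh
  have hk1 : (1 : ℝ) ≤ k := by exact_mod_cast Nat.one_le_iff_ne_zero.2 hk
  have hK0 : 0 < K := by linarith
  refine ⟨x, K * k, C, one_le_mul_of_one_le_of_one_le hK hk1, hC, fun m n => ?_⟩
  have := hx (k * m) (k * n)
  have e : |((k * m : ℤ) : ℝ) - (k * n : ℤ)| = k * |(m : ℝ) - n| := by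
    push_cast
    rw [← mul_sub, abs_mul, Nat.abs_cast]
  rw [e, zpow_mul, zpow_mul, zpow_natCast] at this
  have h0 := abs_nonneg ((m : ℝ) - n)
  refine ⟨le_trans ?_ this.1, this.2.trans_eq (by ring)⟩
  gcongr ?_ - C
  have h1 : 1 / (K * k) ≤ 1 / K :=
    one_div_le_one_div_of_le hK0 (le_mul_of_one_le_right hK0.le hk1)
  have h2 : |(m : ℝ) - n| ≤ k * |(m : ℝ) - n| := le_mul_of_one_le_left h0 hk1
  exact mul_le_mul h1 h2 h0 (by positivity)

variable [GromovHyperbolic X]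

lemma IsLoxodromic.exists_superadditive {h : Γ} (hh : IsLoxodromic X h) (x : X) :
    ∃ D : ℝ, ∀ m n : ℕ,
      dist x (h ^ m • x) + dist x (h ^ n • x) ≤ dist x (h ^ (m + n) • x) + D := by
  obtain ⟨K, C, hK, ha⟩ := hh.exists_growth x
  exact HyperbolicAction.exists_superadditive (p := fun n => h ^ n • x) (dist_pow_smul h x) hK ha

lemma le_gromovProduct_pow_smul {h : Γ} {x : X} {D : ℝ}
    (hD : ∀ m n : ℕ, dist x (h ^ m • x) + dist x (h ^ n • x) ≤ dist x (h ^ (m + n) • x) + D)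
    {m n : ℕ} (hmn : m ≤ n) :
    dist x (h ^ m • x) - D / 2 ≤ gromovProduct x (h ^ m • x) (h ^ n • x) := by
  obtain ⟨k, rfl⟩ := Nat.exists_eq_add_of_le hmn
  have := hD m k
  rw [gromovProduct, dist_pow_smul]
  linarith

lemma IsLoxodromic.tendsto_gromovProduct {h : Γ} (hh : IsLoxodromic X h) (x p : X) :
    Tendsto (fun n : ℕ × ℕ => gromovProduct p (h ^ n.1 • x) (h ^ n.2 • x)) atTop atTop := by
  refine tendsto_gromovProduct_basepoint (p := x) ?_ p
  obtain ⟨D, hD⟩ := hh.exists_superadditive x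
  refine tendsto_atTop.2 fun b => ?_
  obtain ⟨I, hI⟩ := eventually_atTop.1 (tendsto_atTop.1 (hh.tendsto_dist x) (b + D / 2))
  filter_upwards [eventually_ge_atTop (I, I)] with ⟨m, n⟩ hmn
  obtain ⟨hm, hn⟩ := Prod.mk_le_mk.1 hmn
  rcases le_total m n with hle | hle
  · have := le_gromovProduct_pow_smul hD hle
    have := hI m hm
    linarith
  · have h1 := le_gromovProduct_pow_smul hD hle
    have h2 := hI n hn
    rw [gromovProduct_comm] at h1
    linarith

lemma IsLoxodromic.exists_isAttractor {h : Γ} (hh : IsLoxodromic X h) :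
    ∃ ξ : GromovBoundary X, IsAttractor X h ξ := by
  have ⟨x, _⟩ := hh
  have ⟨ξ, hξ⟩ := exists_limit (u := fun n : ℕ => h ^ n • x) (hh.tendsto_gromovProduct x)
  refine ⟨ξ, fun y => ?_⟩
  have hxy : ∀ n : ℕ, dist (h ^ n • x) (h ^ n • y) ≤ dist x y := fun n => (dist_smul _ x y).le
  exact ConvergesTo.of_dist_le (v := fun n : ℕ => h ^ n • y) hξ hxy

lemma isAttractor_inv {h : Γ} {ξ : GromovBoundary X} :
    IsAttractor X h⁻¹ ξ ↔ IsRepeller X h ξ := Iff.rfl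

lemma isRepeller_inv {h : Γ} {ξ : GromovBoundary X} :
    IsRepeller X h⁻¹ ξ ↔ IsAttractor X h ξ := by
  simp only [IsRepeller, IsAttractor, inv_inv]

lemma endpoints_inv (h : Γ) : endpoints X h⁻¹ = endpoints X h := by
  ext ξ
  simp only [endpoints, Set.mem_ofPred_eq, isAttractor_inv, isRepeller_inv, or_comm]

lemma IsLoxodromic.exists_isRepeller {h : Γ} (hh : IsLoxodromic X h) :
    ∃ ξ : GromovBoundary X, IsRepeller X h ξ :=
  hh.inv.exists_isAttractor

lemma IsAttractor.unique [Nonempty X] {h : Γ} {ξ η : GromovBoundary X} (hξ : IsAttractor X h ξ)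
    (hη : IsAttractor X h η) : ξ = η :=
  (hξ (Classical.arbitrary X)).unique (hη _)

lemma endpoints_eq_pair [Nonempty X] {h : Γ} {ξ η : GromovBoundary X} (hη : IsRepeller X h η)
    (hξ : IsAttractor X h ξ) : endpoints X h = {η, ξ} := by
  ext ζ
  constructor
  · rintro (hζ | hζ)
    · exact Or.inl (IsAttractor.unique (h := h⁻¹) hζ hη)
    · exact Or.inr (hζ.unique hξ)
  · rintro (rfl | rfl)
    · exact Or.inl hη
    · exact Or.inr hξ

lemma IsAttractor.pow {h : Γ} {ξ : GromovBoundary X} (hξ : IsAttractor X h ξ) {k : ℕ}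
    (hk : k ≠ 0) : IsAttractor X (h ^ k) ξ := fun x => by
  have := (hξ x).comp (φ := fun n => k * n)
    (tendsto_id.const_mul_atTop' (Nat.pos_of_ne_zero hk))
  simpa only [Function.comp_def, pow_mul] using this

lemma IsAttractor.conj {h : Γ} {ξ : GromovBoundary X} (hξ : IsAttractor X h ξ) (g : Γ) :
    IsAttractor X (g * h * g⁻¹) (g • ξ) := fun x => by
  simpa only [conj_pow, mul_smul] using (hξ (g⁻¹ • x)).smul g

lemma IsAttractor.smul_eq [Nonempty X] {h : Γ} {ξ : GromovBoundary X} (hξ : IsAttractor X h ξ) :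
    h • ξ = ξ := by
  have := hξ.conj h
  rw [mul_inv_cancel_right] at this
  exact this.unique hξ

lemma smul_mem_endpoints_conj {h : Γ} {ξ : GromovBoundary X} (hξ : ξ ∈ endpoints X h) (g : Γ) :
    g • ξ ∈ endpoints X (g * h * g⁻¹) := by
  rcases hξ with hξ | hξ
  · refine Or.inl ?_
    have := IsAttractor.conj (h := h⁻¹) hξ g
    rwa [show g * h⁻¹ * g⁻¹ = (g * h * g⁻¹)⁻¹ by group] at this
  · exact Or.inr (hξ.conj g)

lemma endpoints_conj (h g : Γ) : endpoints X (g * h * g⁻¹) = g • endpoints X h := by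
  ext ξ
  rw [Set.mem_smul_set_iff_inv_smul_mem]
  constructor
  · intro hξ
    have := smul_mem_endpoints_conj hξ g⁻¹
    rwa [show g⁻¹ * (g * h * g⁻¹) * g⁻¹⁻¹ = h by group] at this
  · intro hξ
    simpa only [smul_inv_smul] using smul_mem_endpoints_conj hξ g

lemma smul_eq_of_mem_endpoints [Nonempty X] {h : Γ} {ξ : GromovBoundary X}
    (hξ : ξ ∈ endpoints X h) : h • ξ = ξ := by
  rcases hξ with hξ | hξ
  · rw [← IsAttractor.smul_eq (h := h⁻¹) hξ, smul_inv_smul, IsAttractor.smul_eq (h := h⁻¹) hξ]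
  · exact hξ.smul_eq

/-- Superadditivity bounds the product of `h⁻¹ ^ n • x` and `h ^ n • x` at `x` by `D / 2`. -/
lemma IsLoxodromic.repeller_ne_attractor {h : Γ} (hh : IsLoxodromic X h)
    {ξ η : GromovBoundary X} (hη : IsRepeller X h η) (hξ : IsAttractor X h ξ) : η ≠ ξ := by
  have ⟨x, _⟩ := hh
  obtain ⟨D, hD⟩ := hh.exists_superadditive x
  intro heq
  have h1 := ((hη x).eq_iff (hξ x)).1 heq x
  obtain ⟨n, hn⟩ := (tendsto_atTop.1 h1 (D / 2 + 1)).exists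
  have h2 := hD n n
  have h3 : dist (h⁻¹ ^ n • x) (h ^ n • x) = dist x (h ^ (n + n) • x) := by
    rw [inv_pow, dist_inv_smul, pow_add, mul_smul]
  rw [gromovProduct, h3, dist_inv_pow_smul_self] at hn
  linarith

/-- A loxodromic element fixes no boundary points besides its endpoints. -/
lemma IsLoxodromic.mem_endpoints_of_smul_eq {h : Γ} (hh : IsLoxodromic X h)
    {ζ : GromovBoundary X} (hζ : h • ζ = ζ) : ζ ∈ endpoints X h := by
  have ⟨x, _⟩ := hh
  obtain ⟨ξ, hξ⟩ := hh.exists_isAttractor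
  obtain ⟨η, hη⟩ := hh.exists_isRepeller
  by_contra hmem
  have hne : ζ ≠ ξ := by rintro rfl; exact hmem (Or.inr hξ)
  have hne' : ζ ≠ η := by rintro rfl; exact hmem (Or.inl hη)
  obtain ⟨B₁, I₁, h₁⟩ := exists_gromovProduct_le_of_ne hne (hξ x) x
  obtain ⟨B₂, I₂, h₂⟩ := exists_gromovProduct_le_of_ne hne' (hη x) x
  obtain ⟨D, hD⟩ := hh.exists_superadditive x
  obtain ⟨k, hkI, hk⟩ := ((eventually_ge_atTop I₂).and
    (tendsto_atTop.1 (hh.tendsto_dist x) (B₁ + B₂ + D + 1))).exists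
  obtain ⟨u, hu⟩ := exists_convergesTo ζ
  -- The bound `B₁` does not depend on the sequence, so it applies to this translate although `k`
  -- was chosen later. When the two bounds are added, the distance from `h⁻¹ ^ k • x` to `u i`
  -- cancels, which bounds `dist x (h ^ k • x)`.
  have hku : ConvergesTo (fun n => h ^ k • u n) ζ := by
    simpa only [pow_smul_eq_of_smul_eq hζ k] using hu.smul (h ^ k)
  obtain ⟨i, hi₁, hi₂⟩ := ((h₁ _ hku).and (h₂ _ hu)).exists
  have e₁ := hi₁ (k + I₁) (by omega)
  have e₂ := hi₂ k hkI
  have e₃ := hD k I₁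
  have e₄ : dist x (h ^ k • u i) = dist (h⁻¹ ^ k • x) (u i) := by
    rw [inv_pow, dist_inv_smul]
  have e₅ : dist (h ^ k • u i) (h ^ (k + I₁) • x) = dist (u i) (h ^ I₁ • x) := by
    rw [pow_add, mul_smul, dist_smul]
  rw [gromovProduct, e₄, e₅, dist_comm _ (u i)] at e₁
  rw [gromovProduct, dist_inv_pow_smul_self] at e₂
  have hD0 : 0 ≤ D := by simpa using hD 0 0
  have e₆ := dist_triangle_left (u i) (h ^ I₁ • x) x
  linarith

/-- An isometry that fixes the attracting point of a loxodromic element moves the points of its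
positive half-orbits by a bounded distance. -/
lemma IsLoxodromic.exists_dist_smul_le {h : Γ} (hh : IsLoxodromic X h) {ξ : GromovBoundary X}
    (hξ : IsAttractor X h ξ) {g : Γ} (hg : g • ξ = ξ) (x : X) :
    ∃ R : ℝ, ∀ n : ℕ, dist (h ^ n • x) (g • h ^ n • x) ≤ R := by
  obtain ⟨δ, hδ0, hδ⟩ := exists_pos_delta X
  obtain ⟨D, hD⟩ := hh.exists_superadditive x
  refine ⟨D + 3 * dist x (g • x) + 4 * δ, fun n => ?_⟩
  have hlim := ((hξ x).eq_iff ((hξ x).smul g)).1 hg.symm x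
  obtain ⟨m, hm, hnm⟩ := ((tendsto_atTop.1 hlim (dist x (h ^ n • x))).and
    (eventually_ge_atTop n)).exists
  have h1 := le_gromovProduct_pow_smul hD hnm
  have h2 : gromovProduct (g • x) (g • h ^ m • x) (g • h ^ n • x) =
      gromovProduct x (h ^ n • x) (h ^ m • x) := by
    rw [gromovProduct_smul, inv_smul_smul, gromovProduct_comm]
  have h3 := gromovProduct_sub_dist_le (g • x) x (g • h ^ m • x) (g • h ^ n • x)
  rw [h2, dist_comm] at h3
  have hE : 0 ≤ dist x (g • x) := dist_nonneg
  have hD0 : 0 ≤ D := by simpa using hD 0 0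
  -- Chain `h ^ n • x`, `h ^ m • x`, `g • h ^ m • x`, `g • h ^ n • x` with `m` large. The end points
  -- have product close to their distance from `x`, so they are close together.
  have h4 := le_gromovProduct_of_le hδ
    (c := dist x (h ^ n • x) - D / 2 - dist x (g • x)) (h1.trans' (by linarith))
    (hm.trans' (by linarith))
  have h5 := le_gromovProduct_of_le hδ
    (c := dist x (h ^ n • x) - D / 2 - dist x (g • x) - δ) (z := g • h ^ n • x)
    (h4.trans' (by linarith)) (by linarith)
  have h6 := dist_triangle x (g • x) (g • h ^ n • x)
  rw [dist_smul] at h6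
  rw [gromovProduct] at h5
  linarith

lemma IsLoxodromic.eq_of_inv_pow_smul_eq {h : Γ} (hh : IsLoxodromic X h) {ζ : GromovBoundary X}
    (hζ : ζ ∉ endpoints X h) {m n : ℕ} (hmn : h⁻¹ ^ m • ζ = h⁻¹ ^ n • ζ) : m = n := by
  wlog hle : m ≤ n generalizing m n
  · exact (this hmn.symm (by omega)).symm
  obtain ⟨k, rfl⟩ := Nat.exists_eq_add_of_le hle
  by_contra hne
  have hk : k ≠ 0 := by omega
  rw [pow_add, mul_smul, smul_left_cancel_iff] at hmn
  have hmem := (hh.inv.pow hk).mem_endpoints_of_smul_eq hmn.symm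
  have ⟨x, _⟩ := hh
  have : Nonempty X := ⟨x⟩
  obtain ⟨ξ, hξ⟩ := hh.exists_isAttractor
  obtain ⟨η, hη⟩ := hh.exists_isRepeller
  have h1 : IsAttractor X (h⁻¹ ^ k) η := IsAttractor.pow (h := h⁻¹) hη hk
  have h2 : IsRepeller X (h⁻¹ ^ k) ξ := by
    rw [inv_pow, isRepeller_inv]
    exact hξ.pow hk
  rw [endpoints_eq_pair h2 h1, Set.pair_comm, ← endpoints_eq_pair hη hξ] at hmem
  exact hζ hmem

end Loxodromic

/-! ### WWPD elements -/

section WWPD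

variable {Γ X : Type*} [Group Γ] [MetricSpace X] [MulAction Γ X] [IsIsometricSMul Γ X]
  [GromovHyperbolic X]

/-- Allowing `h = f⁻¹` handles both endpoints of `f` at once. -/
lemma IsWWPD.smul_repeller_eq {f h g : Γ} (hf : IsWWPD X f) (hh : h = f ∨ h = f⁻¹)
    {ξ η : GromovBoundary X} (hη : IsRepeller X h η) (hξ : IsAttractor X h ξ) (hg : g • ξ = ξ) :
    g • η = η := by
  have hlox : IsLoxodromic X h := by
    rcases hh with rfl | rfl
    exacts [hf.1, hf.1.inv]
  have hend : endpoints X f = endpoints X h := by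
    rcases hh with rfl | rfl
    exacts [rfl, (endpoints_inv f).symm]
  have ⟨x, _⟩ := hlox
  have : Nonempty X := ⟨x⟩
  by_contra hne
  have hmem : g • η ∉ endpoints X h := by
    rw [endpoints_eq_pair hη hξ]
    rintro (heq | heq)
    · exact hne heq
    · exact hlox.repeller_ne_attractor hη hξ (smul_left_cancel g (heq.trans hg.symm))
  obtain ⟨R, hR⟩ := hlox.exists_dist_smul_le hξ hg x
  have hR0 : 0 ≤ R := dist_nonneg.trans (hR 0)
  obtain ⟨M, -, hM⟩ := hf.2 x (R + 1) (by linarith)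
  have hconj : ∀ n : ℕ, ∀ y : X,
      dist y (((h ^ n)⁻¹ * g * h ^ n) • y) = dist (h ^ n • y) (g • h ^ n • y) := fun n y => by
    rw [mul_smul, mul_smul, dist_comm, dist_inv_smul, dist_comm]
  -- The shift by `M` keeps `h ^ (n + M) • f ^ M • x` on the positive half-orbit of `h` even when `h
  -- = f⁻¹`.
  set φ : ℕ → Γ := fun n => (h ^ (n + M))⁻¹ * g * h ^ (n + M) with hφ
  have hinj : ∀ m n : ℕ, (φ m : Γ ⧸ orderedStabilizer X f) = φ n → m = n := by
    intro m n hmn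
    have h1 := QuotientGroup.eq.1 hmn
    -- A coset of the stabilizer determines the image of `η`.
    have h2 := (mem_fixingSubgroup_iff Γ).1 h1 η (hend ▸ Or.inl hη)
    rw [mul_smul, inv_smul_eq_iff] at h2
    have h3 : ∀ k : ℕ, φ k • η = h⁻¹ ^ (k + M) • g • η := fun k => by
      have hfix : h • η = η := HyperbolicAction.smul_eq_of_mem_endpoints (Or.inl hη)
      rw [hφ, mul_smul, mul_smul, pow_smul_eq_of_smul_eq hfix, inv_pow]
    rw [h3, h3] at h2
    have := hlox.eq_of_inv_pow_smul_eq hmem h2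
    omega
  have hfin := hM (Set.range φ) (by
    rintro _ ⟨n, rfl⟩
    refine ⟨?_, ?_⟩
    · rw [hconj]
      exact (hR _).trans_lt (by linarith)
    · obtain ⟨k, hk⟩ : ∃ k : ℕ, h ^ (n + M) • f ^ M • x = h ^ k • x := by
        rcases hh with rfl | rfl
        · exact ⟨n + M + M, by rw [pow_add _ (n + M), mul_smul]⟩
        · exact ⟨n, by rw [pow_add, mul_smul, inv_pow f M, inv_smul_smul]⟩
      rw [hconj, hk]
      exact (hR _).trans_lt (by linarith))
    (by
      rintro _ ⟨m, rfl⟩ _ ⟨n, rfl⟩ hmn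
      exact congrArg φ (hinj m n hmn))
  exact Set.infinite_range_of_injective
    (fun m n hmn => hinj m n (congrArg (fun g : Γ => (g : Γ ⧸ orderedStabilizer X f)) hmn)) hfin

/-- An element that fixes one endpoint of a WWPD element fixes both of them. -/
lemma IsWWPD.smul_eq_of_mem_endpoints {f g : Γ} (hf : IsWWPD X f) {ξ η : GromovBoundary X}
    (hξ : ξ ∈ endpoints X f) (hg : g • ξ = ξ) (hη : η ∈ endpoints X f) : g • η = η := by
  obtain ⟨x, _⟩ := hf.1
  have : Nonempty X := ⟨x⟩
  rcases hξ with hξ | hξ <;> rcases hη with hη | hη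
  · rwa [IsAttractor.unique (h := f⁻¹) hη hξ]
  · exact hf.smul_repeller_eq (Or.inr rfl) (isRepeller_inv.2 hη) hξ hg
  · exact hf.smul_repeller_eq (Or.inl rfl) hη hξ hg
  · rwa [hη.unique hξ]

/-- Translates of the endpoint pair of a WWPD element are equal or disjoint. -/
lemma IsWWPD.endpoints_subset_smul {f : Γ} (hf : IsWWPD X f) {g : Γ} {ξ : GromovBoundary X}
    (hξ : ξ ∈ endpoints X f) (hξ' : ξ ∈ g • endpoints X f) :
    endpoints X f ⊆ g • endpoints X f := by
  obtain ⟨x, _⟩ := hf.1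
  have : Nonempty X := ⟨x⟩
  intro η hη
  rw [← endpoints_conj] at hξ' ⊢
  exact (hf.1.conj g).mem_endpoints_of_smul_eq
    (hf.smul_eq_of_mem_endpoints hξ (HyperbolicAction.smul_eq_of_mem_endpoints hξ') hη)

lemma IsWWPD.smul_endpoints_eq {f : Γ} (hf : IsWWPD X f) {g : Γ} {ξ : GromovBoundary X}
    (hξ : ξ ∈ endpoints X f) (hξ' : ξ ∈ g • endpoints X f) :
    g • endpoints X f = endpoints X f := by
  refine Set.Subset.antisymm ?_ (hf.endpoints_subset_smul hξ hξ')
  rw [Set.smul_set_subset_iff_subset_inv_smul_set]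
  refine hf.endpoints_subset_smul (ξ := g⁻¹ • ξ) (Set.mem_smul_set_iff_inv_smul_mem.1 hξ') ?_
  exact Set.smul_mem_smul_set hξ

lemma IsWWPD.isNonelementary_or_isAxial {f : Γ} (hf : IsWWPD X f) :
    IsNonelementary Γ X ∨ IsAxial Γ X := by
  obtain ⟨x, _⟩ := hf.1
  have : Nonempty X := ⟨x⟩
  obtain ⟨ξ, hξ⟩ := hf.1.exists_isAttractor
  obtain ⟨η, hη⟩ := hf.1.exists_isRepeller
  by_cases hall : ∀ g : Γ, g • endpoints X f = endpoints X f
  · rw [endpoints_eq_pair hη hξ] at hall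
    exact Or.inr ⟨η, ξ, hf.1.repeller_ne_attractor hη hξ, hall⟩
  · push Not at hall
    obtain ⟨g, hg⟩ := hall
    refine Or.inl ⟨f, g * f * g⁻¹, hf.1, hf.1.conj g, ?_⟩
    rw [endpoints_conj]
    refine Set.eq_empty_of_forall_notMem fun ζ hζ => hg (hf.smul_endpoints_eq hζ.1 hζ.2)

lemma IsWWPD.not_isQuasiparabolic {f : Γ} (hf : IsWWPD X f) : ¬ IsQuasiparabolic Γ X := by
  rintro ⟨ζ, hζ, g₁, g₂, h₁, h₂, h₁₂⟩
  obtain ⟨ξ, hξ⟩ := hf.1.exists_isAttractor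
  obtain ⟨η, hη⟩ := hf.1.exists_isRepeller
  have hmem : ζ ∈ endpoints X f := hf.1.mem_endpoints_of_smul_eq (hζ f)
  have hsingle : ∀ θ ∈ endpoints X f, θ = ζ := fun θ hθ => by
    have hfix : ∀ g : Γ, g • θ = θ := fun g => hf.smul_eq_of_mem_endpoints hmem (hζ g) hθ
    have : θ ∈ endpoints X g₁ ∩ endpoints X g₂ :=
      ⟨h₁.mem_endpoints_of_smul_eq (hfix g₁), h₂.mem_endpoints_of_smul_eq (hfix g₂)⟩
    rwa [h₁₂] at this
  exact hf.1.repeller_ne_attractor hη hξ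
    ((hsingle η (Or.inl hη)).trans (hsingle ξ (Or.inr hξ)).symm)

end WWPD

end HyperbolicAction

theorem mainTheorem7 {Γ X : Type*} [Group Γ] [MetricSpace X]
    [HyperbolicAction.GeodesicSpace X] [HyperbolicAction.GromovHyperbolic X]
    [MulAction Γ X] [IsIsometricSMul Γ X]
    (hγ : ∃ γ : Γ, HyperbolicAction.IsWWPD X γ) :
    (HyperbolicAction.IsNonelementary Γ X ∨ HyperbolicAction.IsAxial Γ X) ∧
      ¬ HyperbolicAction.IsQuasiparabolic Γ X := by
  obtain ⟨f, hf⟩ := hγ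
  exact ⟨hf.isNonelementary_or_isAxial, hf.not_isQuasiparabolic⟩
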